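/- Let $n$ be a positive integer and let $\widetilde{S}_n$ be the affine symmetric group: the group, under composition, of all bijections $w:\mathbb{Z}\to\mathbb{Z}$ with $w(x+n)=w(x)+n$ for all $x\in\mathbb{Z}$ and $\sum_{i=1}^n w(i)=\binom{n+1}{2}$. For $n\ge 2$ and $i\in\mathbb{Z}/n\mathbb{Z}$ let $s_i\in\widetilde{S}_n$ be the simple transposition with $s_i(x)=x+1$ if $x\equiv i$, $s_i(x)=x-1$ if $x\equiv i+1$, and $s_i(x)=x$ otherwise (congruences modulo $n$); for $n=1$ the group is trivial and the only reduced word is the empty one. A reduced word for $w\in\widetilde{S}_n$ is a word $i_1\cdots i_\ell$ in $\mathbb{Z}/n\mathbb{Z}$ of minimal length with $s_{i_1}\cdots s_{i_\ell}=w$. Two reduced words for $w$ are commutation equivalent if they differ by a sequence of moves replacing two consecutive letters $ij$ by $ji$, where $j\not\equiv i,i+1,i-1 \pmod n$. Let $\mathcal{G}(w)$ be the directed graph whose vertices are the commutation equivalence classes of reduced words for $w$, with an edge $C\to D$ whenever there are reduced words $a\in C$ and $b\in D$ such that $b$ is obtained from $a$ by replacing three consecutive letters $i(i+1)i$ by $(i+1)i(i+1)$,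 for some $i\in\mathbb{Z}/n\mathbb{Z}$. Then for every $w\in\widetilde{S}_n$ the directed graph $\mathcal{G}(w)$ is acyclic (it has no directed cycle), has a unique source (a vertex with no incoming edge), and has a unique sink (a vertex with no outgoing edge). -/

import Mathlib

namespace AffineSymm

/-- The window sum of the identity: `1 + 2 + ⋯ + n = C(n+1, 2)`. -/
theorem sum_window_id (n : ℕ) :
    ∑ i ∈ Finset.Icc (1 : ℤ) n, i = ((n + 1).choose 2 : ℤ) := by
  induction n with
  | zero => simp
  | succ n ih =>
    have h : Finset.Icc (1 : ℤ) ((n + 1 : ℕ) : ℤ)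
        = insert (((n + 1 : ℕ) : ℤ)) (Finset.Icc (1 : ℤ) n) := by
      ext x; simp only [Finset.mem_Icc, Finset.mem_insert]; push_cast; omega
    rw [h, Finset.sum_insert (by simp), ih, Nat.choose_succ_succ' (n + 1) 1]
    push_cast
    simp

theorem periodic_mul {n : ℕ} {w : ℤ → ℤ} (hw : ∀ x, w (x + n) = w x + n) (x k : ℤ) :
    w (x + k * n) = w x + k * n := by
  induction k using Int.induction_on generalizing x with
  | zero => simp
  | succ i ih =>
    have := hw (x + i * n)
    rw [ih] at this
    rw [show x + ((i : ℤ) + 1) * n = x + i * n + n by ring, this]; ring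
  | pred i ih =>
    have := hw (x + (-(i : ℤ) - 1) * n)
    rw [show x + (-(i : ℤ) - 1) * n + n = x + -(i : ℤ) * n by ring, ih] at this
    linarith

/-- The sum of an `n`-periodic function over a window does not change when the window is moved
by an `n`-periodic bijection. -/
theorem sum_window_comp {n : ℕ} {f : ℤ → ℤ} (hf : ∀ x, f (x + n) = f x)
    (v : Equiv.Perm ℤ) (hv : ∀ x, v (x + n) = v x + n) :
    ∑ i ∈ Finset.Icc (1 : ℤ) n, f (v i) = ∑ i ∈ Finset.Icc (1 : ℤ) n, f i := by
  rcases Nat.eq_zero_or_pos n with rfl | hn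
  · simp
  have hn' : (0 : ℤ) < n := by exact_mod_cast hn
  have hfk : ∀ x k : ℤ, f (x + k * n) = f x := by
    intro x k
    exact (show Function.Periodic f (n : ℤ) from hf).int_mul k x
  set e : ℤ → ℤ := fun x => (v x - 1) % n + 1 with he
  have hmaps : ∀ x ∈ Finset.Icc (1 : ℤ) n, e x ∈ Finset.Icc (1 : ℤ) n := by
    intro x _
    have h1 := Int.emod_nonneg (v x - 1) hn'.ne'
    have h2 := Int.emod_lt_of_pos (v x - 1) hn'
    simp only [Finset.mem_Icc, he]
    omega
  have hinj : Set.InjOn e (Finset.Icc (1 : ℤ) n : Finset ℤ) := by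
    intro x hx y hy hxy
    simp only [he] at hxy
    have h1 : (v x - 1) % n = (v y - 1) % n := by linarith
    obtain ⟨k, hk⟩ := Int.ModEq.dvd (show (v y - 1) ≡ (v x - 1) [ZMOD n] from h1.symm)
    have h2 : v x = v (y + k * n) := by
      rw [periodic_mul hv]; linarith
    have h3 := v.injective h2
    simp only [Finset.coe_Icc, Set.mem_Icc] at hx hy
    have hk1 : k < 1 := by by_contra h; push Not at h; nlinarith
    have hk2 : -1 < k := by by_contra h; push Not at h; nlinarith
    have : k = 0 := by omega
    simpa [this] using h3
  refine Finset.sum_nbij e hmaps hinj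
    (Finset.surjOn_of_injOn_of_card_le e hmaps hinj le_rfl) ?_
  intro x _
  have h := Int.emod_add_ediv_mul (v x - 1) n
  rw [show v x = e x + (v x - 1) / n * n by simp only [he]; linarith, hfk]

theorem periodic_inv {n : ℕ} {w : Equiv.Perm ℤ} (hw : ∀ x, w (x + n) = w x + n) (x : ℤ) :
    w⁻¹ (x + n) = w⁻¹ x + n := by
  apply w.injective
  rw [hw]
  simp

theorem sum_window_mul {n : ℕ} {w v : Equiv.Perm ℤ} (hw : ∀ x, w (x + n) = w x + n)
    (hv : ∀ x, v (x + n) = v x + n) :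
    ∑ i ∈ Finset.Icc (1 : ℤ) n, w (v i) + ∑ i ∈ Finset.Icc (1 : ℤ) n, i
      = ∑ i ∈ Finset.Icc (1 : ℤ) n, w i + ∑ i ∈ Finset.Icc (1 : ℤ) n, v i := by
  have h := sum_window_comp (f := fun x => w x - x) (fun x => by simp only [hw]; ring) v hv
  simp only [Finset.sum_sub_distrib] at h
  linarith

/-- The affine symmetric group: all bijections `w : ℤ → ℤ` with `w (x + n) = w x + n` and
`w 1 + ⋯ + w n = C(n+1, 2)`, under composition. -/
def affineSymmetricGroup (n : ℕ) : Subgroup (Equiv.Perm ℤ) where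
  carrier := {w | (∀ x : ℤ, w (x + n) = w x + n) ∧
    ∑ i ∈ Finset.Icc (1 : ℤ) n, w i = ((n + 1).choose 2 : ℤ)}
  one_mem' := ⟨fun _ => rfl, sum_window_id n⟩
  mul_mem' := by
    rintro w v ⟨hw, hw'⟩ ⟨hv, hv'⟩
    refine ⟨fun x => by simp [hv, hw], ?_⟩
    have h := sum_window_mul hw hv
    rw [hw', hv', sum_window_id] at h
    simp only [Equiv.Perm.coe_mul, Function.comp_apply]
    linarith
  inv_mem' := by
    rintro w ⟨hw, hw'⟩
    refine ⟨periodic_inv hw, ?_⟩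
    have h := sum_window_mul hw (periodic_inv hw)
    have h1 : ∀ i : ℤ, w (w⁻¹ i) = i := fun i => by simp
    simp only [h1] at h
    rw [hw', sum_window_id] at h
    linarith

/-- The underlying map of the simple transposition `s_i`: it sends `x ≡ i` to `x + 1`, sends
`x ≡ i + 1` to `x - 1`, and fixes all other integers. For `n = 1` there are no simple
transpositions; the identity is used as a placeholder, which occurs in no reduced word. -/
def simpleFun (n : ℕ) (i : ZMod n) (x : ℤ) : ℤ :=
  if n = 1 then x
  else if (x : ZMod n) = i then x + 1
  else if (x : ZMod n) = i + 1 then x - 1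
  else x

theorem simpleFun_involutive (n : ℕ) (i : ZMod n) : Function.Involutive (simpleFun n i) := by
  intro x
  by_cases hn : n = 1
  · simp [simpleFun, hn]
  have hne : (1 : ZMod n) ≠ 0 := by
    have : Nontrivial (ZMod n) := ZMod.nontrivial_iff.mpr hn
    exact one_ne_zero
  by_cases h1 : (x : ZMod n) = i
  · simp [simpleFun, hn, h1, hne]
  · by_cases h2 : (x : ZMod n) = i + 1
    · simp [simpleFun, hn, h2, hne]
    · simp [simpleFun, hn, h1, h2]

theorem simpleFun_mem (n : ℕ) (i : ZMod n) :
    (simpleFun_involutive n i).toPerm ∈ affineSymmetricGroup n := by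
  by_cases hn : n = 1
  · have : (simpleFun_involutive n i).toPerm = 1 := by
      ext x; simp [simpleFun, hn]
    rw [this]; exact one_mem _
  have hne : (1 : ZMod n) ≠ 0 := by
    have : Nontrivial (ZMod n) := ZMod.nontrivial_iff.mpr hn
    exact one_ne_zero
  refine ⟨fun x => ?_, ?_⟩
  · simp only [Function.Involutive.coe_toPerm, simpleFun, hn, if_false, Int.cast_add,
      Int.cast_natCast, CharP.cast_eq_zero, add_zero]
    split_ifs <;> ring
  · have h := sum_window_comp (n := n) (f := fun x : ℤ => if (x : ZMod n) = i + 1 then (1 : ℤ) else 0)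
      (fun x => by simp) (Equiv.addRight (1 : ℤ)) (fun x => by simp; ring)
    rw [← sum_window_id n]
    have h2 : ∀ x : ℤ, simpleFun n i x = x + (if (((Equiv.addRight (1 : ℤ)) x : ℤ) : ZMod n) = i + 1
        then (1 : ℤ) else 0) - (if (x : ZMod n) = i + 1 then (1 : ℤ) else 0) := by
      intro x
      by_cases h1 : (x : ZMod n) = i
      · simp [simpleFun, hn, h1, hne]
      · by_cases h2 : (x : ZMod n) = i + 1
        · simp [simpleFun, hn, h2, hne]
        · simp [simpleFun, hn, h1, h2]
    simp only [Function.Involutive.coe_toPerm, h2, Finset.sum_sub_distrib, Finset.sum_add_distrib]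
    linarith

/-- The simple transposition `s_i`, `i ∈ ℤ/nℤ`, as an element of the affine symmetric group. -/
def s (n : ℕ) (i : ZMod n) : affineSymmetricGroup n :=
  ⟨(simpleFun_involutive n i).toPerm, simpleFun_mem n i⟩

/-- The product `s_{i₁} ⋯ s_{i_ℓ}` of a word `i₁ ⋯ i_ℓ`. -/
def wordProd {n : ℕ} (a : List (ZMod n)) : affineSymmetricGroup n := (a.map (s n)).prod

/-- `a` is a reduced word for `w`: its product is `w`, and no shorter word has product `w`. -/
def IsReducedWord {n : ℕ} (w : affineSymmetricGroup n) (a : List (ZMod n)) : Prop :=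
  wordProd a = w ∧ ∀ b : List (ZMod n), wordProd b = w → a.length ≤ b.length

/-- The type of reduced words for `w`. -/
def ReducedWord {n : ℕ} (w : affineSymmetricGroup n) : Type :=
  {a : List (ZMod n) // IsReducedWord w a}

/-- `b` arises from `a` by replacing consecutive letters `i j` by `j i`, where
`j` is none of `i`, `i + 1`, `i - 1` modulo `n`. -/
def CommStep {n : ℕ} (a b : List (ZMod n)) : Prop :=
  ∃ (u v : List (ZMod n)) (i j : ZMod n), j ≠ i ∧ j ≠ i + 1 ∧ j ≠ i - 1 ∧
    a = u ++ [i, j] ++ v ∧ b = u ++ [j, i] ++ v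

/-- `b` arises from `a` by replacing consecutive letters `i (i+1) i` by `(i+1) i (i+1)`. -/
def BraidStep {n : ℕ} (a b : List (ZMod n)) : Prop :=
  ∃ (u v : List (ZMod n)) (i : ZMod n),
    a = u ++ [i, i + 1, i] ++ v ∧ b = u ++ [i + 1, i, i + 1] ++ v

/-- Commutation equivalence of reduced words for `w`: the equivalence relation generated by
commutations. -/
def commSetoid {n : ℕ} (w : affineSymmetricGroup n) : Setoid (ReducedWord w) :=
  Relation.EqvGen.setoid fun a b => CommStep a.1 b.1

/-- The commutation classes of reduced words for `w`. -/
def CommClass {n : ℕ} (w : affineSymmetricGroup n) : Type := Quotient (commSetoid w)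

/-- The commutation class of a reduced word. -/
def commClass {n : ℕ} {w : affineSymmetricGroup n} (a : ReducedWord w) : CommClass w :=
  Quotient.mk (commSetoid w) a

/-- The directed braid graph `G(w)` on commutation classes of reduced words for `w`: there is an
edge `C → D` if some representatives of `C` and `D` differ by a braid
`i (i+1) i → (i+1) i (i+1)`. -/
def braidGraph {n : ℕ} (w : affineSymmetricGroup n) : Digraph (CommClass w) where
  Adj C D := ∃ a b : ReducedWord w, commClass a = C ∧ commClass b = D ∧ BraidStep a.1 b.1

/-- A directed graph is acyclic if no directed walk of positive length returns to its start. -/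
def IsAcyclic {V : Type*} (G : Digraph V) : Prop := ∀ v, ¬ Relation.TransGen G.Adj v v

/-- A source: a vertex with no incoming edge. -/
def IsSource {V : Type*} (G : Digraph V) (v : V) : Prop := ∀ u, ¬ G.Adj u v

/-- A sink: a vertex with no outgoing edge. -/
def IsSink {V : Type*} (G : Digraph V) (v : V) : Prop := ∀ u, ¬ G.Adj v u

end AffineSymm

namespace AffineSymm

variable {n : ℕ}

theorem wordProd_nil : wordProd ([] : List (ZMod n)) = 1 := rfl

theorem wordProd_cons (i : ZMod n) (a : List (ZMod n)) : wordProd (i :: a) = s n i * wordProd a := by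
  simp [wordProd]

theorem wordProd_append (a b : List (ZMod n)) : wordProd (a ++ b) = wordProd a * wordProd b := by
  simp [wordProd]

theorem wordProd_singleton (i : ZMod n) : wordProd [i] = s n i := by
  simp [wordProd]

theorem wordProd_concat_apply (u : List (ZMod n)) (i : ZMod n) (x : ℤ) :
    (wordProd (u ++ [i])).1 x = (wordProd u).1 (simpleFun n i x) := by
  rw [wordProd_append, wordProd_singleton]; rfl

theorem s_mul_self (i : ZMod n) : s n i * s n i = 1 := by
  ext x; exact simpleFun_involutive n i x

theorem apply_add (w : affineSymmetricGroup n) (x : ℤ) : w.1 (x + n) = w.1 x + n := w.2.1 x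

theorem apply_add_mul (w : affineSymmetricGroup n) (x k : ℤ) : w.1 (x + k * n) = w.1 x + k * n :=
  periodic_mul w.2.1 x k

theorem zmod_one_ne_zero (hn : n ≠ 1) : (1 : ZMod n) ≠ 0 := by
  have : Nontrivial (ZMod n) := ZMod.nontrivial_iff.mpr hn
  exact one_ne_zero

theorem simpleFun_left (hn : n ≠ 1) {i : ZMod n} {x : ℤ} (h : (x : ZMod n) = i) :
    simpleFun n i x = x + 1 := by
  simp [simpleFun, hn, h]

theorem simpleFun_right (hn : n ≠ 1) {i : ZMod n} {x : ℤ} (h : (x : ZMod n) = i + 1) :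
    simpleFun n i x = x - 1 := by
  simp [simpleFun, hn, h, zmod_one_ne_zero hn]

theorem simpleFun_of_ne {i : ZMod n} {x : ℤ} (h : (x : ZMod n) ≠ i) (h' : (x : ZMod n) ≠ i + 1) :
    simpleFun n i x = x := by
  simp [simpleFun, h, h']

theorem s_mul_comm {i j : ZMod n} (h : j ≠ i) (h1 : j ≠ i + 1) (h2 : j ≠ i - 1) :
    s n i * s n j = s n j * s n i := by
  ext x
  change simpleFun n i (simpleFun n j x) = simpleFun n j (simpleFun n i x)
  by_cases hn : n = 1
  · simp [simpleFun, hn]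
  have h1' := zmod_one_ne_zero hn
  by_cases a : (x : ZMod n) = i
  · rw [simpleFun_left hn a, simpleFun_of_ne (i := j), simpleFun_left hn a, simpleFun_of_ne (i := j)] <;>
      push_cast <;> grind
  by_cases b : (x : ZMod n) = i + 1
  · rw [simpleFun_right hn b, simpleFun_of_ne (i := j), simpleFun_right hn b,
      simpleFun_of_ne (i := j)] <;> push_cast <;> grind
  rw [simpleFun_of_ne a b, simpleFun_of_ne]
  · simp only [simpleFun]; split_ifs <;> push_cast <;> grind
  · simp only [simpleFun]; split_ifs <;> push_cast <;> grind

theorem s_braid (h2 : (2 : ZMod n) ≠ 0) (i : ZMod n) :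
    s n i * (s n (i + 1) * s n i) = s n (i + 1) * (s n i * s n (i + 1)) := by
  have hn : n ≠ 1 := by rintro rfl; exact h2 (Subsingleton.elim _ _)
  have h1 := zmod_one_ne_zero hn
  have k1 : i + 1 ≠ i := by simpa using h1
  have k2 : i + 1 + 1 ≠ i := by rwa [add_assoc, one_add_one_eq_two, Ne, add_eq_left]
  have k3 : i + 1 + 1 ≠ i + 1 := by simpa using h1
  ext x
  change simpleFun n i (simpleFun n (i + 1) (simpleFun n i x)) =
    simpleFun n (i + 1) (simpleFun n i (simpleFun n (i + 1) x))
  by_cases a : (x : ZMod n) = i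
  · rw [simpleFun_left hn a, simpleFun_left (x := x + 1) hn (by push_cast; grind),
      simpleFun_of_ne (x := x + 1 + 1) (by push_cast; grind) (by push_cast; grind),
      simpleFun_of_ne (x := x) (i := i + 1) (by grind) (by grind), simpleFun_left hn a,
      simpleFun_left (x := x + 1) hn (by push_cast; grind)]
  by_cases b : (x : ZMod n) = i + 1
  · rw [simpleFun_right hn b,
      simpleFun_of_ne (x := x - 1) (by push_cast; grind) (by push_cast; grind),
      simpleFun_left (x := x - 1) hn (by push_cast; grind), simpleFun_left (x := x) hn (by grind),
      simpleFun_of_ne (x := x + 1) (by push_cast; grind) (by push_cast; grind),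
      simpleFun_right (x := x + 1) hn (by push_cast; grind)]
    ring
  by_cases c : (x : ZMod n) = i + 1 + 1
  · rw [simpleFun_of_ne a b, simpleFun_right hn c,
      simpleFun_right (x := x - 1) hn (by push_cast; grind),
      simpleFun_of_ne (x := x - 1 - 1) (by push_cast; grind) (by push_cast; grind)]
  · rw [simpleFun_of_ne a b, simpleFun_of_ne b c, simpleFun_of_ne a b, simpleFun_of_ne b c]

theorem s_braid_ne (hn : n ≠ 1) (h2 : (2 : ZMod n) = 0) (i : ZMod n) :
    s n i * (s n (i + 1) * s n i) ≠ s n (i + 1) * (s n i * s n (i + 1)) := by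
  intro h
  obtain ⟨x, hx⟩ := ZMod.intCast_surjective i
  have h : simpleFun n i (simpleFun n (i + 1) (simpleFun n i x)) =
      simpleFun n (i + 1) (simpleFun n i (simpleFun n (i + 1) x)) :=
    congrArg (fun w : affineSymmetricGroup n => w.1 x) h
  rw [simpleFun_left hn hx, simpleFun_left (x := x + 1) hn (by push_cast; grind),
    simpleFun_left (x := x + 1 + 1) hn (by push_cast; grind),
    simpleFun_right (x := x) hn (by grind), simpleFun_right (x := x - 1) hn (by push_cast; grind),
    simpleFun_right (x := x - 1 - 1) hn (by push_cast; grind)] at h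
  omega

/-! ### Exchange and descents -/

/-- The exchange property at a descent. -/
theorem exists_word_mul_s (hn : n ≠ 1) (u : List (ZMod n)) {i : ZMod n} {x : ℤ}
    (hx : (x : ZMod n) = i) (h : (wordProd u).1 (x + 1) < (wordProd u).1 x) :
    ∃ u', u'.length + 1 = u.length ∧ wordProd u' = wordProd u * s n i := by
  induction u with
  | nil => simp [wordProd_nil] at h
  | cons k u ih =>
    by_cases hlt : (wordProd u).1 (x + 1) < (wordProd u).1 x
    · obtain ⟨u', h1, h2⟩ := ih hlt
      exact ⟨k :: u', by simp [h1], by simp only [wordProd_cons, h2, mul_assoc]⟩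
    · refine ⟨u, rfl, ?_⟩
      have hne : (wordProd u).1 (x + 1) ≠ (wordProd u).1 x := fun e => by
        have := (wordProd u).1.injective e
        omega
      set p := (wordProd u).1 x with hp
      set q := (wordProd u).1 (x + 1) with hq
      have happ : ∀ y, (wordProd (k :: u)).1 y = simpleFun n k ((wordProd u).1 y) := fun y => by
        rw [wordProd_cons]; rfl
      rw [happ, happ, ← hp, ← hq] at h
      have hpk : (p : ZMod n) = k ∧ q = p + 1 := by
        simp only [simpleFun, hn, if_false] at h
        have h1 := zmod_one_ne_zero hn
        have hcast : q = p + 1 → (q : ZMod n) = p + 1 := fun e => by rw [e]; push_cast; rfl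
        split_ifs at h <;> first | omega | grind
      obtain ⟨hpk, hpq⟩ := hpk
      suffices hs : s n k * wordProd u = wordProd u * s n i by
        rw [wordProd_cons, hs, mul_assoc, s_mul_self, mul_one]
      ext y
      change simpleFun n k ((wordProd u).1 y) = (wordProd u).1 (simpleFun n i y)
      have key : ∀ z t : ℤ, ((wordProd u).1 z : ZMod n) = ((wordProd u).1 t : ℤ) →
          ∃ m : ℤ, z = t + m * n := by
        intro z t hzt
        obtain ⟨m, hm⟩ := (ZMod.intCast_eq_intCast_iff_dvd_sub _ _ n).1 hzt.symm
        refine ⟨m, (wordProd u).1.injective ?_⟩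
        rw [apply_add_mul]; linarith
      by_cases ha : (y : ZMod n) = i
      · obtain ⟨m, hm⟩ := (ZMod.intCast_eq_intCast_iff_dvd_sub _ _ n).1 (hx.trans ha.symm)
        obtain rfl : y = x + m * n := by linarith
        rw [simpleFun_left hn ha, add_right_comm, apply_add_mul, apply_add_mul, ← hp, ← hq, hpq,
          simpleFun_left hn (by simpa using hpk)]
        ring
      by_cases hb : (y : ZMod n) = i + 1
      · have : ((x + 1 : ℤ) : ZMod n) = y := by push_cast; rw [hx, hb]
        obtain ⟨m, hm⟩ := (ZMod.intCast_eq_intCast_iff_dvd_sub _ _ n).1 this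
        obtain rfl : y = x + 1 + m * n := by linarith
        rw [simpleFun_right hn hb, show x + 1 + m * n - 1 = x + m * n by ring, apply_add_mul,
          apply_add_mul, ← hp, ← hq, hpq, simpleFun_right hn (by simpa using hpk)]
        ring
      · rw [simpleFun_of_ne ha hb, simpleFun_of_ne]
        · intro e
          obtain ⟨m, rfl⟩ := key y x (by rw [e, ← hp, hpk])
          exact ha (by simpa using hx)
        · intro e
          obtain ⟨m, rfl⟩ := key y (x + 1) (by rw [e, ← hq, hpq]; push_cast; rw [hpk])
          exact hb (by simpa using hx)

theorem IsReducedWord.length_eq {w : affineSymmetricGroup n} {a b : List (ZMod n)}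
    (ha : IsReducedWord w a) (hb : IsReducedWord w b) : a.length = b.length :=
  le_antisymm (ha.2 b hb.1) (hb.2 a ha.1)

theorem isReducedWord_of_eq {w : affineSymmetricGroup n} {a b : List (ZMod n)}
    (ha : IsReducedWord w a) (h : wordProd b = wordProd a) (hl : b.length = a.length) :
    IsReducedWord w b :=
  ⟨h.trans ha.1, fun c hc => hl ▸ ha.2 c hc⟩

theorem IsReducedWord.left {w : affineSymmetricGroup n} {a b : List (ZMod n)}
    (h : IsReducedWord w (a ++ b)) : IsReducedWord (wordProd a) a := by
  refine ⟨rfl, fun c hc => ?_⟩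
  have := h.2 (c ++ b) (by rw [wordProd_append, hc, ← wordProd_append, h.1])
  simpa using this

theorem IsReducedWord.ne_one {w : affineSymmetricGroup n} {u : List (ZMod n)} {i : ZMod n}
    (h : IsReducedWord w (u ++ [i])) : n ≠ 1 := by
  rintro rfl
  have : s 1 i = 1 := by ext x; simp [s, simpleFun]
  have h1 := h.2 u (by rw [← h.1, wordProd_append, wordProd_singleton, this, mul_one])
  simp at h1

theorem IsReducedWord.concat_concat_ne {w : affineSymmetricGroup n} {u : List (ZMod n)}
    {k i : ZMod n} (h : IsReducedWord w (u ++ [k] ++ [i])) : k ≠ i := by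
  rintro rfl
  have h1 := h.2 u (by
    rw [← h.1, wordProd_append, wordProd_append, wordProd_singleton, mul_assoc, s_mul_self,
      mul_one])
  simp at h1

/-- The last letter of a reduced word is a descent. -/
theorem IsReducedWord.descent {w : affineSymmetricGroup n} {u : List (ZMod n)} {i : ZMod n}
    (h : IsReducedWord w (u ++ [i])) {x : ℤ} (hx : (x : ZMod n) = i) : w.1 (x + 1) < w.1 x := by
  have hn := h.ne_one
  by_contra hlt
  have hne : w.1 (x + 1) ≠ w.1 x := fun e => by
    have := w.1.injective e
    omega
  rw [← h.1] at hlt hne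
  rw [wordProd_concat_apply, wordProd_concat_apply, simpleFun_left hn hx, simpleFun_right hn (by
    push_cast; rw [hx]), add_sub_cancel_right] at hlt hne
  obtain ⟨u', h1, h2⟩ := exists_word_mul_s hn u hx (by omega)
  have := h.2 u' (by rw [h2, ← wordProd_singleton, ← wordProd_append, h.1])
  simp at this
  omega

/-! ### Words generate the affine symmetric group -/

theorem eq_one_of_no_descent (hn : 0 < n) (w : affineSymmetricGroup n)
    (h : ∀ x, w.1 x ≤ w.1 (x + 1)) : w = 1 := by
  have hmono : Monotone fun x => w.1 x - x := by
    refine monotone_int_of_le_succ fun x => ?_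
    have : w.1 x ≠ w.1 (x + 1) := fun e => by
      have := w.1.injective e
      omega
    have := h x
    omega
  have hsucc : ∀ x, w.1 (x + 1) - (x + 1) = w.1 x - x := by
    intro x
    refine le_antisymm ?_ (hmono (by omega))
    have := hmono (show x + 1 ≤ x + n by omega)
    simp only [apply_add] at this
    linarith
  have hconst : ∀ x : ℤ, w.1 x = x + w.1 0 := by
    intro x
    induction x using Int.induction_on with
    | zero => simp
    | succ i ih => linarith [hsucc i]
    | pred i ih =>
      have := hsucc (-i - 1)
      rw [sub_add_cancel] at this
      linarith
  have hsum := w.2.2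
  rw [Finset.sum_congr rfl fun x _ => hconst x, ← sum_window_id, Finset.sum_add_distrib, add_eq_left, Finset.sum_const] at hsum
  have h0 : w.1 0 = 0 := by simpa [hn.ne'] using hsum
  ext x
  rw [hconst, h0, add_zero]
  rfl

/-- The squared displacement of a window. -/
noncomputable def displacement (w : affineSymmetricGroup n) : ℤ := ∑ x ∈ Finset.Icc (1 : ℤ) n, (w.1 x - x) ^ 2

theorem displacement_mul_s_lt (hn : 0 < n) (hn1 : n ≠ 1) (w : affineSymmetricGroup n) {x : ℤ}
    (hx : w.1 (x + 1) < w.1 x) : displacement (w * s n (x : ZMod n)) < displacement w := by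
  set i : ZMod n := (x : ZMod n) with hi
  have h1 := zmod_one_ne_zero hn1
  have hper : ∀ y : ℤ, w.1 (y + n) = w.1 y + n := apply_add w
  have hsper : ∀ y : ℤ, simpleFun n i (y + n) = simpleFun n i y + n := (simpleFun_mem n i).1
  have e1 : displacement (w * s n i) =
      ∑ y ∈ Finset.Icc (1 : ℤ) n, (w.1 y - simpleFun n i y) ^ 2 := by
    have := sum_window_comp (n := n) (f := fun y => (w.1 y - simpleFun n i y) ^ 2)
      (fun y => by simp only [hper, hsper]; ring) (s n i).1 (apply_add (s n i))
    rw [← this]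
    refine Finset.sum_congr rfl fun y _ => ?_
    change (w.1 (simpleFun n i y) - y) ^ 2 =
      (w.1 (simpleFun n i y) - simpleFun n i (simpleFun n i y)) ^ 2
    rw [simpleFun_involutive n i y]
  have e2 := sum_window_comp (n := n)
    (f := fun y : ℤ => if (y : ZMod n) = i + 1 then 2 * (w.1 y - y) + 1 else 0)
    (fun y => by simp only [hper]; push_cast; rw [ZMod.natCast_self, add_zero]; congr 1; ring)
    (Equiv.addRight (1 : ℤ)) (fun y => by simp; ring)
  have e3 : displacement (w * s n i) - displacement w =
      ∑ y ∈ Finset.Icc (1 : ℤ) n, if (y : ZMod n) = i then 2 * (w.1 (y + 1) - w.1 y) else 0 := by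
    have : displacement (w * s n i) - displacement w =
        ∑ y ∈ Finset.Icc (1 : ℤ) n, (if (y : ZMod n) = i then -2 * (w.1 y - y) + 1 else 0) +
        ∑ y ∈ Finset.Icc (1 : ℤ) n,
          (if (y : ZMod n) = i + 1 then 2 * (w.1 y - y) + 1 else 0) := by
      rw [e1, displacement, ← Finset.sum_sub_distrib, ← Finset.sum_add_distrib]
      refine Finset.sum_congr rfl fun y _ => ?_
      by_cases a : (y : ZMod n) = i
      · rw [simpleFun_left hn1 a, if_pos a, if_neg (by simp [a, h1])]; ring
      by_cases b : (y : ZMod n) = i + 1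
      · rw [simpleFun_right hn1 b, if_neg a, if_pos b]; ring
      · rw [simpleFun_of_ne a b, if_neg a, if_neg b]; ring
    rw [this, ← e2, ← Finset.sum_add_distrib]
    refine Finset.sum_congr rfl fun y _ => ?_
    by_cases a : (y : ZMod n) = i
    · simp [a]; ring
    · simp [a]
  suffices h : displacement (w * s n i) - displacement w < 0 by linarith
  rw [e3]
  have hneg : ∀ y : ℤ, (y : ZMod n) = i → 2 * (w.1 (y + 1) - w.1 y) < 0 := by
    intro y hy
    obtain ⟨m, hm⟩ := (ZMod.intCast_eq_intCast_iff_dvd_sub _ _ n).1 (hi.symm.trans hy.symm)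
    obtain rfl : y = x + m * n := by linarith
    rw [add_right_comm, apply_add_mul, apply_add_mul]
    linarith
  refine Finset.sum_neg' (fun y _ => ?_) ⟨(x - 1) % n + 1, ?_, ?_⟩
  · split_ifs with a
    · exact (hneg y a).le
    · exact le_rfl
  · have := Int.emod_nonneg (x - 1) (b := n) (by omega)
    have := Int.emod_lt_of_pos (x - 1) (b := n) (by omega)
    rw [Finset.mem_Icc]
    omega
  · have : (((x - 1) % n + 1 : ℤ) : ZMod n) = i := by simp [hi]
    rw [if_pos this]
    exact hneg _ this

theorem exists_wordProd_eq (hn : 0 < n) (w : affineSymmetricGroup n) :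
    ∃ a : List (ZMod n), wordProd a = w := by
  induction hd : (displacement w).toNat using Nat.strong_induction_on generalizing w with
  | _ d ih =>
  by_cases h : ∀ x, w.1 x ≤ w.1 (x + 1)
  · exact ⟨[], (eq_one_of_no_descent hn w h).symm⟩
  push Not at h
  obtain ⟨x, hx⟩ := h
  have hn1 : n ≠ 1 := by
    rintro rfl
    have := apply_add w x
    push_cast at this
    omega
  have hlt := displacement_mul_s_lt hn hn1 w hx
  have h0 : 0 ≤ displacement (w * s n (x : ZMod n)) := Finset.sum_nonneg fun _ _ => sq_nonneg _
  obtain ⟨a, ha⟩ := ih _ (by omega) (w * s n (x : ZMod n)) rfl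
  exact ⟨a ++ [(x : ZMod n)], by
    rw [wordProd_append, ha, wordProd_singleton, mul_assoc, s_mul_self, mul_one]⟩

theorem exists_isReducedWord (hn : 0 < n) (w : affineSymmetricGroup n) :
    ∃ a, IsReducedWord w a := by
  obtain ⟨a, ha, hmin⟩ := (measure (List.length (α := ZMod n))).wf.has_min
    {a | wordProd a = w} (exists_wordProd_eq hn w)
  exact ⟨a, ha, fun b hb => not_lt.1 (hmin b hb)⟩

/-! ### Commutation equivalence of words -/

/-- Commutation equivalence of arbitrary words. -/
abbrev CommEq : List (ZMod n) → List (ZMod n) → Prop := Relation.EqvGen CommStep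

theorem CommStep.context {a b : List (ZMod n)} (h : CommStep a b) (u v : List (ZMod n)) :
    CommStep (u ++ a ++ v) (u ++ b ++ v) := by
  obtain ⟨p, q, i, j, h1, h2, h3, rfl, rfl⟩ := h
  exact ⟨u ++ p, q ++ v, i, j, h1, h2, h3, by simp, by simp⟩

theorem CommEq.trans {a b c : List (ZMod n)} (h : CommEq a b) (h' : CommEq b c) : CommEq a c :=
  Relation.EqvGen.trans _ _ _ h h'

theorem CommEq.symm {a b : List (ZMod n)} (h : CommEq a b) : CommEq b a :=
  Relation.EqvGen.symm _ _ h

theorem CommEq.refl (a : List (ZMod n)) : CommEq a a := Relation.EqvGen.refl a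

theorem CommEq.append_right {a b : List (ZMod n)} (h : CommEq a b) (v : List (ZMod n)) :
    CommEq (a ++ v) (b ++ v) := by
  induction h with
  | rel a b h => exact .rel _ _ (by simpa using h.context [] v)
  | refl a => exact .refl _
  | symm a b _ ih => exact Relation.EqvGen.symm _ _ ih
  | trans a b c _ _ ih ih' => exact Relation.EqvGen.trans _ _ _ ih ih'

theorem CommEq.swap {i j : ZMod n} (h : j ≠ i) (h1 : j ≠ i + 1) (h2 : j ≠ i - 1)
    (u : List (ZMod n)) : CommEq (u ++ [i] ++ [j]) (u ++ [j] ++ [i]) :=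
  .rel _ _ ⟨u, [], i, j, h, h1, h2, by simp, by simp⟩

theorem CommStep.wordProd_eq {a b : List (ZMod n)} (h : CommStep a b) :
    wordProd a = wordProd b := by
  obtain ⟨p, q, i, j, h1, h2, h3, rfl, rfl⟩ := h
  simp only [wordProd_append, wordProd_cons, wordProd_nil, mul_one, s_mul_comm h1 h2 h3]

theorem CommEq.wordProd_eq {a b : List (ZMod n)} (h : CommEq a b) : wordProd a = wordProd b := by
  induction h with
  | rel a b h => exact h.wordProd_eq
  | refl a => rfl
  | symm a b _ ih => exact ih.symm
  | trans a b c _ _ ih ih' => exact ih.trans ih'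

theorem CommEq.length_eq {a b : List (ZMod n)} (h : CommEq a b) : a.length = b.length := by
  induction h with
  | rel a b h => obtain ⟨p, q, i, j, -, -, -, rfl, rfl⟩ := h; simp
  | refl a => rfl
  | symm a b _ ih => exact ih.symm
  | trans a b c _ _ ih ih' => exact ih.trans ih'

theorem CommEq.isReducedWord {w : affineSymmetricGroup n} {a b : List (ZMod n)} (h : CommEq a b)
    (ha : IsReducedWord w a) : IsReducedWord w b :=
  isReducedWord_of_eq ha h.wordProd_eq.symm h.length_eq.symm

theorem commClass_eq_iff {w : affineSymmetricGroup n} {a b : ReducedWord w} :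
    commClass a = commClass b ↔ CommEq a.1 b.1 := by
  constructor
  · intro h
    have h' : Relation.EqvGen (fun a b : ReducedWord w => CommStep a.1 b.1) a b := Quotient.exact h
    clear h
    induction h' with
    | rel a b h => exact Relation.EqvGen.rel _ _ h
    | refl a => exact Relation.EqvGen.refl _
    | symm a b _ ih => exact Relation.EqvGen.symm _ _ ih
    | trans a b c _ _ ih ih' =>
      exact Relation.EqvGen.trans _ _ _ ih ih'
  · obtain ⟨a, ha⟩ := a
    obtain ⟨b, hb⟩ := b
    intro h
    change CommEq a b at h
    refine Quotient.sound ?_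
    change Relation.EqvGen (fun a b : ReducedWord w => CommStep a.1 b.1) _ _
    induction h with
    | rel a b h => exact .rel _ _ h
    | refl a => exact .refl _
    | symm a b _ ih => exact .symm _ _ (ih _ _)
    | trans a b c h _ ih ih' =>
      exact .trans _ _ _ (ih ha (CommEq.isReducedWord h ha)) (ih' _ _)

theorem BraidStep.length_eq {a b : List (ZMod n)} (h : BraidStep a b) : a.length = b.length := by
  obtain ⟨p, q, i, rfl, rfl⟩ := h
  simp

theorem BraidStep.append_right {a b : List (ZMod n)} (h : BraidStep a b) (v : List (ZMod n)) :
    BraidStep (a ++ v) (b ++ v) := by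
  obtain ⟨p, q, i, rfl, rfl⟩ := h
  exact ⟨p, q ++ v, i, by simp, by simp⟩

/-! ### Terminal words -/

/-- A reduced word no commutation of which admits an upward braid to another reduced word. -/
def IsTerminal (a : List (ZMod n)) : Prop :=
  IsReducedWord (wordProd a) a ∧
    ∀ a' b, CommEq a a' → BraidStep a' b → wordProd b ≠ wordProd a

theorem IsTerminal.congr {a b : List (ZMod n)} (ha : IsTerminal a) (h : CommEq a b) :
    IsTerminal b :=
  ⟨h.wordProd_eq ▸ h.isReducedWord ha.1, fun a' c h1 h2 =>
    h.wordProd_eq ▸ ha.2 a' c (h.trans h1) h2⟩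

theorem IsTerminal.left {a v : List (ZMod n)} (ha : IsTerminal (a ++ v)) : IsTerminal a :=
  ⟨ha.1.left, fun a' b h1 h2 e => ha.2 (a' ++ v) (b ++ v) (h1.append_right v) (h2.append_right v)
    (by rw [wordProd_append, wordProd_append, e])⟩

theorem IsTerminal.no_braid {u : List (ZMod n)} {i : ZMod n} (h2 : (2 : ZMod n) ≠ 0)
    (h : IsTerminal (u ++ [i] ++ [i + 1] ++ [i])) : False :=
  h.2 _ (u ++ [i + 1, i, i + 1] ++ []) (.refl _) ⟨u, [], i, by simp, rfl⟩ (by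
    simp only [List.append_assoc, wordProd_append, wordProd_cons, wordProd_nil, List.cons_append,
      List.nil_append, mul_one, s_braid h2])

/-- The value at `x` is smaller than all values to its right. -/
def IsRightMin (w : affineSymmetricGroup n) (x : ℤ) : Prop := ∀ y, x < y → w.1 x < w.1 y

/-- Right minima persist under swaps of two positions on the same side. -/
theorem IsRightMin.mul_s {w : affineSymmetricGroup n} {x : ℤ} (h : IsRightMin w x) {k : ZMod n}
    (h1 : (x : ZMod n) ≠ k) (h2 : (x : ZMod n) ≠ k + 1) : IsRightMin (w * s n k) x := by
  intro y hy
  change w.1 (simpleFun n k x) < w.1 (simpleFun n k y)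
  rw [simpleFun_of_ne h1 h2]
  refine h _ ?_
  by_contra hlt
  have hxy : y = x + 1 ∧ (y : ZMod n) = k + 1 := by
    simp only [simpleFun] at hlt
    split_ifs at hlt with h3 h4 h5
    · omega
    · omega
    · exact ⟨by omega, h5⟩
    · omega
  obtain ⟨rfl, h3⟩ := hxy
  exact h1 (by simpa using h3)

/-- In terminal words ending in `i`, the smaller value moved by that letter is a right minimum. -/
def TerminalLast (m : ℕ) (n : ℕ) : Prop :=
  ∀ (u : List (ZMod n)) (x : ℤ), u.length < m → IsTerminal (u ++ [(x : ZMod n)]) →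
    IsRightMin (wordProd (u ++ [(x : ZMod n)])) (x + 1)

/-- A terminal word can end in any descent whose smaller value is a right minimum. -/
def TerminalDescent (m : ℕ) (n : ℕ) : Prop :=
  ∀ (a : List (ZMod n)) (x : ℤ), a.length ≤ m → IsTerminal a →
    (wordProd a).1 (x + 1) < (wordProd a).1 x → IsRightMin (wordProd a) (x + 1) →
    ∃ u, CommEq a (u ++ [(x : ZMod n)])

theorem wordProd_mul_s_of_concat (u : List (ZMod n)) (k : ZMod n) :
    wordProd (u ++ [k]) * s n k = wordProd u := by
  rw [wordProd_append, wordProd_singleton, mul_assoc, s_mul_self, mul_one]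

theorem terminalDescent_succ {m : ℕ} (hA : TerminalLast (m + 1) n) (hB : TerminalDescent m n) :
    TerminalDescent (m + 1) n := by
  intro a x ha hterm hdesc hmin
  rcases List.eq_nil_or_concat a with rfl | ⟨u, k, rfl⟩
  · simp [wordProd_nil] at hdesc
  rw [List.concat_eq_append] at *
  obtain ⟨z, rfl⟩ := ZMod.intCast_surjective k
  have hn := hterm.1.ne_one
  have hlen : u.length < m + 1 := by simpa using ha
  by_cases h0 : (z : ZMod n) = x
  · exact ⟨u, by rw [h0]; exact .refl _⟩
  have h1 : (z : ZMod n) ≠ x + 1 := by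
    intro e
    have := hterm.1.descent (x := x + 1) (by rw [e]; push_cast; rfl)
    have := hmin (x + 1 + 1) (by omega)
    omega
  have h2 : (z : ZMod n) ≠ x - 1 := by
    intro e
    have e' : ((x - 1 : ℤ) : ZMod n) = z := by rw [e]; push_cast; rfl
    rw [← e'] at hterm hdesc hmin
    have := hA u (x - 1) hlen hterm (x + 1) (by omega)
    rw [sub_add_cancel] at this
    omega
  have happ : wordProd u = wordProd (u ++ [(z : ZMod n)]) * s n z :=
    (wordProd_mul_s_of_concat _ _).symm
  have hx1 : ((x + 1 : ℤ) : ZMod n) ≠ z := by push_cast; exact h1.symm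
  have hx2 : ((x + 1 : ℤ) : ZMod n) ≠ z + 1 := by push_cast; simpa using Ne.symm h0
  have hx3 : (x : ZMod n) ≠ z + 1 := fun e => h2 (by rw [e]; ring)
  obtain ⟨u', hu'⟩ := hB u x (by omega) hterm.left (by
    rw [happ]
    change (wordProd _).1 (simpleFun n z (x + 1)) < (wordProd _).1 (simpleFun n z x)
    rwa [simpleFun_of_ne hx1 hx2, simpleFun_of_ne (Ne.symm h0) hx3])
    (by rw [happ]; exact hmin.mul_s hx1 hx2)
  exact ⟨u' ++ [(z : ZMod n)], (hu'.append_right _).trans (CommEq.swap h0 h1 h2 u')⟩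

theorem terminalLast_succ {m : ℕ} (hA : TerminalLast m n) (hB : TerminalDescent (m - 1) n) :
    TerminalLast (m + 1) n := by
  intro u x hlen hterm
  have hn := hterm.1.ne_one
  by_contra hmin
  simp only [IsRightMin] at hmin
  push Not at hmin
  obtain ⟨y, hy, hle⟩ := hmin
  have hdesc := hterm.1.descent (x := x) rfl
  set i : ZMod n := (x : ZMod n) with hi
  set w := wordProd (u ++ [i]) with hw
  have hinj : ∀ p q : ℤ, w.1 p ≤ w.1 q → p ≠ q → w.1 p < w.1 q := fun p q h hne =>
    lt_of_le_of_ne h fun e => hne (w.1.injective e)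
  have hlt : w.1 y < w.1 (x + 1) := hinj _ _ hle (by omega)
  have hyi : (y : ZMod n) ≠ i := by
    intro e
    obtain ⟨c, hc⟩ := (ZMod.intCast_eq_intCast_iff_dvd_sub _ _ n).1 (hi.symm.trans e.symm)
    obtain rfl : y = x + c * n := by linarith
    rw [apply_add_mul] at hlt
    linarith
  have hyi1 : (y : ZMod n) ≠ i + 1 := by
    intro e
    have e' : ((x + 1 : ℤ) : ZMod n) = y := by rw [e]; push_cast; rfl
    obtain ⟨c, hc⟩ := (ZMod.intCast_eq_intCast_iff_dvd_sub _ _ n).1 e'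
    obtain rfl : y = x + 1 + c * n := by linarith
    rw [apply_add_mul] at hlt
    linarith
  have hwv : ∀ z, (wordProd u).1 z = w.1 (simpleFun n i z) := fun z => by
    rw [← wordProd_mul_s_of_concat u i]; rfl
  have hv0 : (wordProd u).1 x = w.1 (x + 1) := by rw [hwv, simpleFun_left hn hi]
  have hvy : (wordProd u).1 y = w.1 y := by rw [hwv, simpleFun_of_ne hyi hyi1]
  rcases List.eq_nil_or_concat u with rfl | ⟨u, k, rfl⟩
  · simp only [wordProd_nil] at hv0 hvy
    change x = _ at hv0
    change y = _ at hvy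
    omega
  simp only [List.concat_eq_append] at *
  obtain ⟨z, hz⟩ := ZMod.intCast_surjective k
  have hlen' : u.length < m := by
    simp at hlen
    omega
  have h0 : k ≠ i := hterm.1.concat_concat_ne
  by_cases h1 : k = i - 1
  · have e' : ((x - 1 : ℤ) : ZMod n) = k := by rw [h1]; push_cast; rfl
    have := hA u (x - 1) hlen' (by rw [e']; exact hterm.left) y (by omega)
    rw [e', sub_add_cancel, hv0, hvy] at this
    omega
  by_cases h2 : k = i + 1
  · have e' : ((x + 1 : ℤ) : ZMod n) = k := by rw [h2]; push_cast; rfl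
    have htwo : (2 : ZMod n) ≠ 0 := by
      intro e
      apply h1
      rw [h2]
      linear_combination e
    have hright := hA u (x + 1) hlen' (by rw [e']; exact hterm.left)
    rw [e'] at hright
    have hy2 : (wordProd (u ++ [k])).1 (x + 1 + 1) ≤ (wordProd (u ++ [k])).1 y := by
      rcases eq_or_lt_of_le (show x + 1 + 1 ≤ y by omega) with e | h
      · rw [e]
      · exact (hright y h).le
    have hvs : ∀ t, (wordProd u).1 t = (wordProd (u ++ [k])).1 (simpleFun n k t) := fun t => by
      rw [← wordProd_mul_s_of_concat u k]; rfl
    have hx1 : (wordProd u).1 (x + 1) = (wordProd (u ++ [k])).1 (x + 1 + 1) := by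
      rw [hvs, simpleFun_left hn e']
    have hx0 : (wordProd u).1 x = (wordProd (u ++ [k])).1 x := by
      rw [hvs, simpleFun_of_ne]
      · rw [← hi]; exact h0.symm
      · rw [← hi, h2]
        intro e
        exact htwo (by linear_combination -e)
    obtain ⟨u', hu'⟩ := hB u x (by omega) hterm.left.left (by rw [hx0, hx1, hv0]; omega) (by
      intro t ht
      rw [hx1, hvs]
      rcases eq_or_lt_of_le (show x + 1 + 1 ≤ t by omega) with e | ht2
      · rw [simpleFun_right hn (by rw [← e, ← e']; push_cast; rfl), ← e, add_sub_cancel_right]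
        exact hterm.left.1.descent e'
      refine hright _ ?_
      simp only [simpleFun]
      split_ifs with a b c
      · omega
      · omega
      · by_contra h3
        obtain rfl : t = x + 1 + 1 + 1 := by omega
        rw [← e'] at c
        push_cast at c
        exact zmod_one_ne_zero hn (by linear_combination c)
      · omega)
    have hbr := hterm.congr ((hu'.append_right _).append_right _)
    rw [h2] at hbr
    exact hbr.no_braid htwo
  · have hsw := CommEq.swap (i := k) (j := i) h0.symm (fun e => h1 (by rw [e]; ring))
      (fun e => h2 (by rw [e]; ring)) u
    have ht' := hterm.congr hsw
    have := (hA u x hlen' ht'.left).mul_s (k := k)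
      (by push_cast; rw [← hi]; exact Ne.symm h2) (by push_cast; simpa [← hi] using h0.symm) y hy
    rw [← hi, ← wordProd_singleton, ← wordProd_append, ← hsw.wordProd_eq, ← hw] at this
    omega

theorem terminalLast_and_terminalDescent (n m : ℕ) : TerminalLast m n ∧ TerminalDescent m n := by
  induction m using Nat.strong_induction_on with
  | _ m ih =>
  rcases m with _ | m
  · refine ⟨fun u x h => absurd h (by omega), fun a x h _ hdesc => ?_⟩
    obtain rfl : a = [] := by simpa using h
    simp [wordProd_nil] at hdesc
  · have hA := terminalLast_succ (ih m (by omega)).1 (ih (m - 1) (by omega)).2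
    exact ⟨hA, terminalDescent_succ hA (ih m (by omega)).2⟩

theorem IsTerminal.commEq {a b : List (ZMod n)} (ha : IsTerminal a) (hb : IsTerminal b)
    (h : wordProd a = wordProd b) : CommEq a b := by
  induction hm : a.length generalizing a b with
  | zero =>
    have hl := ha.1.length_eq (h ▸ hb.1)
    obtain rfl : a = [] := by simpa using hm
    obtain rfl : b = [] := by simpa using hl.symm
    exact .refl _
  | succ m ih =>
    rcases List.eq_nil_or_concat a with rfl | ⟨u, k, rfl⟩
    · simp at hm
    rw [List.concat_eq_append] at *
    obtain ⟨x, rfl⟩ := ZMod.intCast_surjective k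
    have hmin := (terminalLast_and_terminalDescent n _).1 u x (Nat.lt_succ_self _) ha
    have hdesc := ha.1.descent (x := x) rfl
    rw [h] at hmin hdesc
    obtain ⟨u', hu'⟩ := (terminalLast_and_terminalDescent n _).2 b x le_rfl hb hdesc hmin
    have huu : CommEq u u' := by
      refine ih ha.left (hb.congr hu').left ?_ (by simpa using hm)
      rw [← wordProd_mul_s_of_concat u (x : ZMod n), ← wordProd_mul_s_of_concat u' (x : ZMod n), h,
        hu'.wordProd_eq]
    exact (huu.append_right _).trans hu'.symm

/-! ### A potential that increases along braids -/

/-- The doubled midpoint of positions minus the sum of the values at positions `x`, `x + 1`, for the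
standard representative `x` of `i`. -/
def crossing (g : affineSymmetricGroup n) (i : ZMod n) : ℤ :=
  2 * (i.cast : ℤ) + 1 - g.1 (i.cast : ℤ) - g.1 ((i.cast : ℤ) + 1)

theorem crossing_eq (g : affineSymmetricGroup n) {i : ZMod n} {x : ℤ} (hx : (x : ZMod n) = i) :
    crossing g i = 2 * x + 1 - g.1 x - g.1 (x + 1) := by
  have hc : (((i.cast : ℤ)) : ZMod n) = i := ZMod.intCast_zmod_cast i
  obtain ⟨m, hm⟩ := (ZMod.intCast_eq_intCast_iff_dvd_sub _ _ n).1 (hc.trans hx.symm)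
  obtain rfl : x = (i.cast : ℤ) + m * n := by linarith
  rw [add_right_comm, apply_add_mul, apply_add_mul, crossing]
  ring

/-- The sum of the crossings along a word that starts at `g`. -/
def potential (g : affineSymmetricGroup n) : List (ZMod n) → ℤ
  | [] => 0
  | i :: a => crossing g i + potential (g * s n i) a

theorem potential_append (g : affineSymmetricGroup n) (a b : List (ZMod n)) :
    potential g (a ++ b) = potential g a + potential (g * wordProd a) b := by
  induction a generalizing g with
  | nil => simp [potential, wordProd_nil]
  | cons i a ih => simp only [List.cons_append, potential, ih, wordProd_cons, mul_assoc, add_assoc]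

theorem crossing_mul_s_of_ne (g : affineSymmetricGroup n) {i j : ZMod n} (h : j ≠ i)
    (h1 : j ≠ i + 1) (h2 : j ≠ i - 1) : crossing (g * s n i) j = crossing g j := by
  obtain ⟨x, rfl⟩ := ZMod.intCast_surjective j
  rw [crossing_eq _ rfl, crossing_eq _ rfl]
  change 2 * x + 1 - g.1 (simpleFun n i x) - g.1 (simpleFun n i (x + 1)) = _
  rw [simpleFun_of_ne h h1, simpleFun_of_ne]
  · push_cast
    exact fun e => h2 (by rw [← e]; ring)
  · push_cast
    simpa using h

theorem CommStep.potential_eq {a b : List (ZMod n)} (h : CommStep a b) :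
    potential 1 a = potential 1 b := by
  obtain ⟨p, q, i, j, h1, h2, h3, rfl, rfl⟩ := h
  have hp : wordProd (p ++ [i, j]) = wordProd (p ++ [j, i]) := by
    simp only [wordProd_append, wordProd_cons, wordProd_nil, mul_one, s_mul_comm h1 h2 h3]
  rw [potential_append, potential_append _ (p ++ [j, i]), hp, potential_append,
    potential_append _ p [j, i]]
  simp only [potential]
  rw [crossing_mul_s_of_ne _ h1 h2 h3, crossing_mul_s_of_ne _ h1.symm
    (fun e => h3 (by rw [e]; ring)) (fun e => h2 (by rw [e]; ring))]
  ring

theorem CommEq.potential_eq {a b : List (ZMod n)} (h : CommEq a b) :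
    potential 1 a = potential 1 b := by
  induction h with
  | rel a b h => exact h.potential_eq
  | refl a => rfl
  | symm a b _ ih => exact ih.symm
  | trans a b c _ _ ih ih' => exact ih.trans ih'

theorem potential_braid (h2 : (2 : ZMod n) ≠ 0) (g : affineSymmetricGroup n) (i : ZMod n) :
    potential g [i + 1, i, i + 1] = potential g [i, i + 1, i] + 2 := by
  have hn : n ≠ 1 := by rintro rfl; exact h2 (Subsingleton.elim _ _)
  have h1 := zmod_one_ne_zero hn
  have k1 : i + 1 ≠ i := by simpa using h1
  have k2 : i + 1 + 1 ≠ i := by rwa [add_assoc, one_add_one_eq_two, Ne, add_eq_left]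
  have k3 : i + 1 + 1 ≠ i + 1 := by simpa using h1
  obtain ⟨x, hx⟩ := ZMod.intCast_surjective i
  have hx1 : ((x + 1 : ℤ) : ZMod n) = i + 1 := by push_cast; rw [hx]
  have hx2 : ((x + 1 + 1 : ℤ) : ZMod n) = i + 1 + 1 := by push_cast; rw [hx]
  have a0 : simpleFun n i x = x + 1 := simpleFun_left hn hx
  have a1 : simpleFun n i (x + 1) = x := by rw [simpleFun_right hn hx1]; ring
  have a2 : simpleFun n i (x + 1 + 1) = x + 1 + 1 :=
    simpleFun_of_ne (hx2 ▸ k2) (hx2 ▸ k3)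
  have b0 : simpleFun n (i + 1) x = x := simpleFun_of_ne (hx ▸ k1.symm) (hx ▸ k2.symm)
  have b1 : simpleFun n (i + 1) (x + 1) = x + 1 + 1 := simpleFun_left hn hx1
  have b2 : simpleFun n (i + 1) (x + 1 + 1) = x + 1 := by rw [simpleFun_right hn hx2]; ring
  have hs : ∀ (h : affineSymmetricGroup n) (j : ZMod n) (y : ℤ),
      (h * s n j).1 y = h.1 (simpleFun n j y) := fun _ _ _ => rfl
  simp only [potential, crossing_eq _ hx, crossing_eq _ hx1, hs, a0, a1, a2, b0, b1, b2]
  ring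

theorem BraidStep.potential_eq {w : affineSymmetricGroup n} {a b : List (ZMod n)}
    (h : BraidStep a b) (ha : IsReducedWord w a) (hb : wordProd b = w) :
    potential 1 b = potential 1 a + 2 := by
  obtain ⟨p, q, i, rfl, rfl⟩ := h
  have hp := ha.1.trans hb.symm
  simp only [wordProd_append, wordProd_cons, wordProd_nil, mul_one, mul_left_inj,
    mul_right_inj] at hp
  have hn : n ≠ 1 := by
    have h3 : p ++ [i, i + 1, i] = p ++ [i, i + 1] ++ [i] := by simp
    have h4 := ha.left
    rw [h3] at h4
    exact h4.ne_one
  have h2 : (2 : ZMod n) ≠ 0 := fun h2 => s_braid_ne hn h2 i hp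
  have hw : wordProd (p ++ [i, i + 1, i]) = wordProd (p ++ [i + 1, i, i + 1]) := by
    simp only [wordProd_append, wordProd_cons, wordProd_nil, mul_one, s_braid h2]
  rw [potential_append, potential_append _ (p ++ [i, i + 1, i]), hw, potential_append,
    potential_append _ p [i, i + 1, i], potential_braid h2]
  ring

/-! ### Reflection of words -/

/-- The word with all letters negated. -/
abbrev reflect (a : List (ZMod n)) : List (ZMod n) := a.map Neg.neg

theorem reflect_reflect (a : List (ZMod n)) : reflect (reflect a) = a := by
  simp [reflect]

theorem simpleFun_neg (i : ZMod n) (x : ℤ) : simpleFun n (-i) (1 - x) = 1 - simpleFun n i x := by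
  by_cases hn : n = 1
  · simp [simpleFun, hn]
  by_cases a : (x : ZMod n) = i
  · rw [simpleFun_left hn a, simpleFun_right hn (by push_cast; rw [a]; ring)]; ring
  by_cases b : (x : ZMod n) = i + 1
  · rw [simpleFun_right hn b, simpleFun_left hn (by push_cast; rw [b]; ring)]; ring
  · rw [simpleFun_of_ne a b, simpleFun_of_ne]
    · push_cast
      exact fun e => b (by linear_combination -e)
    · push_cast
      exact fun e => a (by linear_combination -e)

theorem wordProd_reflect_apply (a : List (ZMod n)) (x : ℤ) :
    (wordProd (reflect a)).1 (1 - x) = 1 - (wordProd a).1 x := by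
  induction a with
  | nil => rfl
  | cons i a ih =>
    change (wordProd (-i :: reflect a)).1 (1 - x) = _
    rw [wordProd_cons, wordProd_cons]
    change simpleFun n (-i) ((wordProd (reflect a)).1 (1 - x)) = 1 - simpleFun n i _
    rw [ih, simpleFun_neg]

theorem wordProd_reflect_congr {a b : List (ZMod n)} (h : wordProd a = wordProd b) :
    wordProd (reflect a) = wordProd (reflect b) := by
  ext x
  have ha := wordProd_reflect_apply a (1 - x)
  have hb := wordProd_reflect_apply b (1 - x)
  rw [sub_sub_cancel] at ha hb
  rw [ha, hb, h]

theorem wordProd_reflect_eq_iff {a b : List (ZMod n)} :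
    wordProd (reflect a) = wordProd (reflect b) ↔ wordProd a = wordProd b :=
  ⟨fun h => by simpa only [reflect_reflect] using wordProd_reflect_congr h, wordProd_reflect_congr⟩

theorem isReducedWord_reflect {a : List (ZMod n)} (h : IsReducedWord (wordProd a) a) :
    IsReducedWord (wordProd (reflect a)) (reflect a) := by
  refine ⟨rfl, fun b hb => ?_⟩
  rw [← reflect_reflect b, wordProd_reflect_eq_iff] at hb
  simpa using h.2 _ hb

theorem CommStep.reflect {a b : List (ZMod n)} (h : CommStep a b) :
    CommStep (reflect a) (reflect b) := by
  obtain ⟨p, q, i, j, h1, h2, h3, rfl, rfl⟩ := h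
  refine ⟨p.map Neg.neg, q.map Neg.neg, -i, -j, by simpa using h1, fun e => h3 ?_, fun e => h2 ?_,
    by simp, by simp⟩
  · linear_combination -e
  · linear_combination -e

theorem CommEq.reflect {a b : List (ZMod n)} (h : CommEq a b) :
    CommEq (reflect a) (reflect b) := by
  induction h with
  | rel a b h => exact Relation.EqvGen.rel _ _ h.reflect
  | refl a => exact Relation.EqvGen.refl _
  | symm a b _ ih => exact Relation.EqvGen.symm _ _ ih
  | trans a b c _ _ ih ih' => exact Relation.EqvGen.trans _ _ _ ih ih'

theorem BraidStep.reflect {a b : List (ZMod n)} (h : BraidStep a b) :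
    BraidStep (reflect b) (reflect a) := by
  obtain ⟨p, q, i, rfl, rfl⟩ := h
  exact ⟨p.map Neg.neg, q.map Neg.neg, -(i + 1), by simp, by simp⟩

/-! ### Sources and sinks of the braid graph -/

theorem isTerminal_of_isSink {w : affineSymmetricGroup n} {a : ReducedWord w}
    (h : IsSink (braidGraph w) (commClass a)) : IsTerminal a.1 := by
  refine ⟨a.2.1.symm ▸ a.2, fun a' b haa' hstep e => ?_⟩
  have ha' : IsReducedWord w a' := haa'.isReducedWord a.2
  have hb : IsReducedWord w b :=
    isReducedWord_of_eq ha' (e.trans haa'.wordProd_eq) hstep.length_eq.symm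
  exact h (commClass ⟨b, hb⟩) ⟨⟨a', ha'⟩, ⟨b, hb⟩, commClass_eq_iff.2 haa'.symm, rfl, hstep⟩

theorem isTerminal_reflect_of_isSource {w : affineSymmetricGroup n} {a : ReducedWord w}
    (h : IsSource (braidGraph w) (commClass a)) : IsTerminal (reflect a.1) := by
  refine ⟨isReducedWord_reflect (a.2.1.symm ▸ a.2), fun a' b haa' hstep e => ?_⟩
  have haa' : CommEq a.1 (reflect a') := by simpa only [reflect_reflect] using haa'.reflect
  have ha' : IsReducedWord w (reflect a') := haa'.isReducedWord a.2
  have e' : wordProd (reflect b) = wordProd a.1 := by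
    simpa only [reflect_reflect] using wordProd_reflect_congr e
  have hb : IsReducedWord w (reflect b) :=
    isReducedWord_of_eq ha' (e'.trans haa'.wordProd_eq) hstep.reflect.length_eq
  exact h (commClass ⟨_, hb⟩)
    ⟨⟨_, hb⟩, ⟨_, ha'⟩, rfl, commClass_eq_iff.2 haa'.symm, hstep.reflect⟩

theorem commClass_surjective (w : affineSymmetricGroup n) (C : CommClass w) :
    ∃ a : ReducedWord w, commClass a = C := Quotient.exists_rep C

theorem isSink_unique {w : affineSymmetricGroup n} {C D : CommClass w}
    (hC : IsSink (braidGraph w) C) (hD : IsSink (braidGraph w) D) : C = D := by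
  obtain ⟨a, rfl⟩ := commClass_surjective w C
  obtain ⟨b, rfl⟩ := commClass_surjective w D
  exact commClass_eq_iff.2 ((isTerminal_of_isSink hC).commEq (isTerminal_of_isSink hD)
    (a.2.1.trans b.2.1.symm))

theorem isSource_unique {w : affineSymmetricGroup n} {C D : CommClass w}
    (hC : IsSource (braidGraph w) C) (hD : IsSource (braidGraph w) D) : C = D := by
  obtain ⟨a, rfl⟩ := commClass_surjective w C
  obtain ⟨b, rfl⟩ := commClass_surjective w D
  have := (isTerminal_reflect_of_isSource hC).commEq (isTerminal_reflect_of_isSource hD)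
    (wordProd_reflect_congr (a.2.1.trans b.2.1.symm))
  exact commClass_eq_iff.2 (by simpa only [reflect_reflect] using this.reflect)

/-- The potential of a commutation class. -/
def classPotential {w : affineSymmetricGroup n} (C : CommClass w) : ℤ :=
  Quotient.lift (s := commSetoid w) (fun a => potential 1 a.1)
    (fun _ _ h => (commClass_eq_iff.1 (Quotient.sound h)).potential_eq) C

theorem classPotential_lt_of_adj {w : affineSymmetricGroup n} {C D : CommClass w}
    (h : (braidGraph w).Adj C D) : classPotential C < classPotential D := by
  obtain ⟨a, b, rfl, rfl, h⟩ := h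
  have := h.potential_eq a.2 b.2.1
  change potential 1 a.1 < potential 1 b.1
  omega

theorem finite_commClass (hn : 0 < n) (w : affineSymmetricGroup n) : Finite (CommClass w) := by
  have : NeZero n := ⟨hn.ne'⟩
  obtain ⟨a, ha⟩ := exists_isReducedWord hn w
  have : Finite (ReducedWord w) :=
    ((List.finite_length_eq (ZMod n) a.length).subset fun b hb =>
      IsReducedWord.length_eq hb ha).to_subtype
  exact Quotient.finite _

theorem nonempty_commClass (hn : 0 < n) (w : affineSymmetricGroup n) : Nonempty (CommClass w) := by
  obtain ⟨a, ha⟩ := exists_isReducedWord hn w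
  exact ⟨commClass ⟨a, ha⟩⟩

end AffineSymm

theorem mainTheorem2 (n : ℕ) (hn : 0 < n) (w : AffineSymm.affineSymmetricGroup n) :
    AffineSymm.IsAcyclic (AffineSymm.braidGraph w) ∧
      (∃! C : AffineSymm.CommClass w, AffineSymm.IsSource (AffineSymm.braidGraph w) C) ∧
      (∃! C : AffineSymm.CommClass w, AffineSymm.IsSink (AffineSymm.braidGraph w) C) := by
  have := AffineSymm.finite_commClass hn w
  have := AffineSymm.nonempty_commClass hn w
  refine ⟨fun C hC => ?_, ?_, ?_⟩
  · have hlt : ∀ D, Relation.TransGen (AffineSymm.braidGraph w).Adj C D →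
        AffineSymm.classPotential C < AffineSymm.classPotential D := by
      intro D hD
      induction hD with
      | single h => exact AffineSymm.classPotential_lt_of_adj h
      | tail _ h ih => exact ih.trans (AffineSymm.classPotential_lt_of_adj h)
    exact lt_irrefl _ (hlt C hC)
  · obtain ⟨C, hC⟩ := Finite.exists_min (AffineSymm.classPotential (w := w))
    have hs : AffineSymm.IsSource (AffineSymm.braidGraph w) C := fun D hD =>
      (hC D).not_gt (AffineSymm.classPotential_lt_of_adj hD)
    exact ⟨C, hs, fun D hD => AffineSymm.isSource_unique hD hs⟩
  · obtain ⟨C, hC⟩ := Finite.exists_max (AffineSymm.classPotential (w := w))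
    have hs : AffineSymm.IsSink (AffineSymm.braidGraph w) C := fun D hD =>
      (hC D).not_gt (AffineSymm.classPotential_lt_of_adj hD)
    exact ⟨C, hs, fun D hD => AffineSymm.isSink_unique hD hs⟩
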